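/- Let $(M,w)$ be a Poisson manifold: a smooth $n$-manifold $M$ with a smooth bivector field $w$ whose Schouten--Nijenhuis bracket $[w,w]$ vanishes. For a tangent vector $v$ and a $k$-form $\alpha$ put $(v\vdash\alpha)(v_1,\dots,v_{k-1})=\alpha(v,v_1,\dots,v_{k-1})$ and $(\alpha\dashv v)(v_1,\dots,v_{k-1})=\alpha(v_1,\dots,v_{k-1},v)$, and let $P\vdash\alpha$, for a multivector $P$, be the extension with $(u\wedge v)\vdash\alpha=u\vdash(v\vdash\alpha)$. Wedge products of forms are normalized so that $(\xi\wedge\eta)(u,v)=\xi(u)\eta(v)-\xi(v)\eta(u)$ for $1$-forms $\xi,\eta$, and similarly for multivectors. For a basis $e_i$ of a tangent space with dual basis $e^i$ let $w^{ij}=w(e^i,e^j)$, so that $w=\sum_{i<j}w^{ij}e_i\wedge e_j$ and $w\vdash\alpha=\frac12\sum_{i,j}w^{ij}\,e_i\vdash(e_j\vdash\alpha)$. The quantum exterior product is defined fiberwise by $$\alpha\wedge_h\beta=\sum_{r\ge0}\frac{h^r}{r!}\sum_{i_1,j_1,\dots,i_r,j_r}w^{i_1j_1}\cdots w^{i_rj_r}\,(\alpha\dashv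 e_{i_1}\dashv\cdots\dashv e_{i_r})\wedge(e_{j_r}\vdash\cdots\vdash e_{j_1}\vdash\beta),$$ and is extended $\mathbb R[h]$-bilinearly to $\Omega(M)[h]=\Omega(M)\otimes_{\mathbb R}\mathbb R[h]$ and $\mathbb R[h,h^{-1}]$-bilinearly to $\Omega(M)[h,h^{-1}]=\Omega(M)\otimes_{\mathbb R}\mathbb R[h,h^{-1}]$. Koszul's operator is $\delta\alpha=w\vdash d\alpha-d(w\vdash\alpha)$ and the quantum exterior differential is $d_h=d-h\delta$, both extended linearly over $\mathbb R[h]$, respectively $\mathbb R[h,h^{-1}]$. The variable $h$ has degree $2$, and $|\alpha|$ is the total degree of a homogeneous element $\alpha$. **Theorem.** For every Poisson manifold $(M,w)$, $$d_h(\alpha\wedge_h\beta)=(d_h\alpha)\wedge_h\beta+(-1)^{|\alpha|}\,\alpha\wedge_h(d_h\beta)$$ for all $\alpha,\beta\in\Omega(M)[h]$ with $\alpha$ homogeneous, and likewise for all $\alpha,\beta\in\Omega(M)[h,h^{-1}]$ with $\alpha$ homogeneous. -/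

import Mathlib

open scoped Manifold ContDiff

noncomputable section

namespace QuantumDeRham

/-! ### Linear algebra: contractions and the quantum exterior product -/

section LinearAlgebra

universe u

variable {V : Type u} [AddCommGroup V] [Module ℝ V]

/-- The exterior algebra `Λ(V*)` of the dual space. -/
abbrev DualExt (V : Type u) [AddCommGroup V] [Module ℝ V] : Type u :=
  ExteriorAlgebra ℝ (Module.Dual ℝ V)

/-- The left contraction `v ⊢ α`: `v` is inserted in the first slot of `α`. It is the
antiderivation of `Λ(V*)` with `v ⊢ ξ = ξ v` for covectors `ξ`. -/
def contrL : V →ₗ[ℝ] Module.End ℝ (DualExt V) :=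
  CliffordAlgebra.contractLeft ∘ₗ Module.Dual.eval ℝ V

/-- The right contraction `α ⊣ v`: `v` is inserted in the last slot of `α`, so that
`(α ∧ ξ) ⊣ v = ξ v • α - (α ⊣ v) ∧ ξ` for covectors `ξ`. -/
def contrR (α : DualExt V) (v : V) : DualExt V :=
  CliffordAlgebra.contractRight α (Module.Dual.eval ℝ V v)

theorem contrL_mul_self (v : V) : contrL v * contrL v = 0 :=
  LinearMap.ext fun α => CliffordAlgebra.contractLeft_contractLeft (Module.Dual.eval ℝ V v) α

/-- The interior product `P ⊢ α` of forms with multivectors: the action of the algebra `Λ(V)` on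
`Λ(V*)` that extends the left contraction by vectors, so `(u ∧ v) ⊢ α = u ⊢ (v ⊢ α)`. -/
def interiorMul : ExteriorAlgebra ℝ V →ₐ[ℝ] Module.End ℝ (DualExt V) :=
  ExteriorAlgebra.lift ℝ ⟨contrL, contrL_mul_self⟩

/-- The component `w(ξ, η)` of a bivector `w`; for `w = u ∧ v` it is `ξ u * η v - ξ v * η u`.
(Contract `w` first with `ξ`, then with `η`, and read off the degree zero part.) -/
def component (w : ExteriorAlgebra ℝ V) (ξ η : Module.Dual ℝ V) : ℝ :=
  ExteriorAlgebra.algebraMapInv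
    (CliffordAlgebra.contractLeft η (CliffordAlgebra.contractLeft ξ w))

/-- For a basis `e` of `V` and `w^{ij} = w(e^i, e^j)`, the sum
`∑ w^{i₁j₁} ⋯ w^{iᵣjᵣ} (α ⊣ e_{i₁} ⊣ ⋯ ⊣ e_{iᵣ}) ∧ (e_{jᵣ} ⊢ ⋯ ⊢ e_{j₁} ⊢ β)`
over all indices `i₁, j₁, …, iᵣ, jᵣ`. -/
def contractedWedge {ι : Type*} [Fintype ι] (e : Module.Basis ι ℝ V)
    (w : ExteriorAlgebra ℝ V) : ℕ → DualExt V → DualExt V → DualExt V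
  | 0, α, β => α * β
  | r + 1, α, β => ∑ i, ∑ j, component w (e.coord i) (e.coord j) •
      contractedWedge e w r (contrR α (e i)) (contrL (e j) β)

/-- The coefficient of `h ^ r` in the quantum exterior product `α ∧_{h,w} β` of
`α, β ∈ Λ(V*)`. It does not depend on the basis, and it vanishes for `r > dim V`. -/
def quantumCoeff [Module.Finite ℝ V] (w : ExteriorAlgebra ℝ V) (r : ℕ) (α β : DualExt V) :
    DualExt V :=
  (r.factorial : ℝ)⁻¹ • contractedWedge (Module.finBasis ℝ V) w r α β

instance extFinite [Module.Finite ℝ V] : Module.Finite ℝ (ExteriorAlgebra ℝ V) := by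
  classical
  have hbot : ∀ i, Module.finrank ℝ V < i → (⋀[ℝ]^i V : Submodule ℝ (ExteriorAlgebra ℝ V)) = ⊥ := by
    intro i hi
    apply Submodule.finrank_eq_zero.1
    rw [exteriorPower.finrank_eq, Nat.choose_eq_zero_of_lt hi]
  have htop : (⨆ i, ⋀[ℝ]^i V : Submodule ℝ (ExteriorAlgebra ℝ V)) = ⊤ :=
    (DirectSum.Decomposition.isInternal
      (fun i => (⋀[ℝ]^i V : Submodule ℝ (ExteriorAlgebra ℝ V)))).submodule_iSup_eq_top
  have hle : (⊤ : Submodule ℝ (ExteriorAlgebra ℝ V)) =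
      ⨆ i ∈ Finset.range (Module.finrank ℝ V + 1), ⋀[ℝ]^i V := by
    rw [← htop]
    apply le_antisymm
    · refine iSup_le fun i => ?_
      by_cases hi : Module.finrank ℝ V < i
      · rw [hbot i hi]; exact bot_le
      · exact le_iSup₂_of_le i (Finset.mem_range.2 (by omega)) le_rfl
    · exact iSup₂_le fun i _ => le_iSup (fun i => (⋀[ℝ]^i V : Submodule ℝ (ExteriorAlgebra ℝ V))) i
  refine ⟨?_⟩
  rw [hle]
  exact Submodule.fg_biSup _ _ fun i _ => Module.Finite.iff_fg.1 inferInstance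

end LinearAlgebra

/-! ### Calculus in `ℝⁿ` for functions with values in a finite-dimensional vector space -/

section Calculus

/-- The model space `ℝⁿ`. -/
abbrev Model (n : ℕ) : Type := EuclideanSpace ℝ (Fin n)

variable {n : ℕ} {W : Type*} [AddCommGroup W] [Module ℝ W]

/-- Smoothness of all the components of `f` on `s`. -/
def SmoothOn (f : Model n → W) (s : Set (Model n)) : Prop :=
  ∀ l : Module.Dual ℝ W, ContDiffOn ℝ ∞ (fun y => l (f y)) s

/-- The partial derivative `∂_i f` at `y`, taken componentwise in a basis of `W`. -/
def pderiv [Module.Finite ℝ W] (i : Fin n) (f : Model n → W) (y : Model n) : W :=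
  ∑ k, fderiv ℝ (fun z => (Module.finBasis ℝ W).coord k (f z)) y (EuclideanSpace.single i 1) •
    Module.finBasis ℝ W k

/-- The coordinate covector `dx^i` of `ℝⁿ`. -/
def dx (i : Fin n) : Module.Dual ℝ (Model n) :=
  (EuclideanSpace.basisFun (Fin n) ℝ).toBasis.coord i

/-- The exterior derivative in coordinates: `∑ dx^i ∧ ∂_i f`. -/
def localExtDeriv (f : Model n → DualExt (Model n)) (y : Model n) : DualExt (Model n) :=
  ∑ i, ExteriorAlgebra.ι ℝ (dx i) * pderiv i f y

/-- The Schouten-Nijenhuis bracket of multivector fields in coordinates: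
`∑ (P ⌊ dx^i) ∧ ∂_i Q - ∂_i P ∧ (dx^i ⌋ Q)`. -/
def localSchouten (P Q : Model n → ExteriorAlgebra ℝ (Model n)) (y : Model n) :
    ExteriorAlgebra ℝ (Model n) :=
  ∑ i, (CliffordAlgebra.contractRight (P y) (dx i) * pderiv i Q y -
    pderiv i P y * CliffordAlgebra.contractLeft (dx i) (Q y))

end Calculus

/-! ### Differential forms and multivector fields on a manifold -/

section Manifolds

variable {n : ℕ} {M : Type*} [TopologicalSpace M] [ChartedSpace (Model n) M]

instance tangentFinite (x : M) : Module.Finite ℝ (TangentSpace (𝓡 n) x) :=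
  inferInstanceAs (Module.Finite ℝ (Model n))

variable (n M)

/-- Fields of (inhomogeneous) exterior forms on `M`, with no regularity. -/
abbrev Form : Type _ := (x : M) → DualExt (TangentSpace (𝓡 n) x)

/-- Fields of (inhomogeneous) multivectors on `M`, with no regularity. -/
abbrev Multivector : Type _ := (x : M) → ExteriorAlgebra ℝ (TangentSpace (𝓡 n) x)

variable {n M}

/-- The differential at `x` of the chart `φ` around `p`. -/
def chartDiff (p x : M) : TangentSpace (𝓡 n) x →ₗ[ℝ] Model n :=
  (mfderiv (𝓡 n) 𝓘(ℝ, Model n) (extChartAt (𝓡 n) p) x).toLinearMap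

/-- The differential at `y` of the inverse of the chart `φ` around `p`. -/
def chartDiffSymm (p : M) (y : Model n) :
    Model n →ₗ[ℝ] TangentSpace (𝓡 n) ((extChartAt (𝓡 n) p).symm y) :=
  (mfderiv 𝓘(ℝ, Model n) (𝓡 n) (extChartAt (𝓡 n) p).symm y).toLinearMap

/-- The differential of the inverse of the chart around `p` at the image of `p`, with values in the
tangent space at `p`. -/
def chartDiffSymmAt (p : M) : Model n →ₗ[ℝ] TangentSpace (𝓡 n) p :=
  chartDiffSymm p (extChartAt (𝓡 n) p p)

/-- The expression of a form in the chart around `p`: its pullback by the inverse chart. -/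
def Form.inChart (a : Form n M) (p : M) (y : Model n) : DualExt (Model n) :=
  ExteriorAlgebra.map (chartDiffSymm p y).dualMap (a ((extChartAt (𝓡 n) p).symm y))

/-- The expression of a multivector field in the chart around `p`: its pushforward by the chart. -/
def Multivector.inChart (P : Multivector n M) (p : M) (y : Model n) :
    ExteriorAlgebra ℝ (Model n) :=
  ExteriorAlgebra.map (chartDiff p ((extChartAt (𝓡 n) p).symm y))
    (P ((extChartAt (𝓡 n) p).symm y))

/-- `a` is a smooth differential form: an element of `Ω(M)`. -/
def Form.IsSmooth (a : Form n M) : Prop :=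
  ∀ p : M, SmoothOn (a.inChart p) (extChartAt (𝓡 n) p).target

/-- `P` is a smooth multivector field. -/
def Multivector.IsSmooth (P : Multivector n M) : Prop :=
  ∀ p : M, SmoothOn (P.inChart p) (extChartAt (𝓡 n) p).target

/-- `a` is homogeneous of degree `k`, i.e. a `k`-form. -/
def Form.IsHomogeneous (a : Form n M) (k : ℕ) : Prop :=
  ∀ x : M, a x ∈ ⋀[ℝ]^k (Module.Dual ℝ (TangentSpace (𝓡 n) x))

/-- The exterior derivative `d`. At `p` it is computed in the chart around `p`. -/
def extD (a : Form n M) : Form n M := fun p =>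
  ExteriorAlgebra.map (chartDiff p p).dualMap
    (localExtDeriv (a.inChart p) (extChartAt (𝓡 n) p p))

/-- The Schouten-Nijenhuis bracket. At `p` it is computed in the chart around `p`. -/
def schouten (P Q : Multivector n M) : Multivector n M := fun p =>
  ExteriorAlgebra.map (chartDiffSymmAt p)
    (localSchouten (P.inChart p) (Q.inChart p) (extChartAt (𝓡 n) p p))

/-- A Poisson structure on `M`: a smooth bivector field `w` with `[w, w] = 0`. -/
structure IsPoisson (w : Multivector n M) : Prop where
  bivector : ∀ x : M, w x ∈ ⋀[ℝ]^2 (TangentSpace (𝓡 n) x)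
  smooth : w.IsSmooth
  schouten_self : schouten w w = 0

/-- The fiberwise interior product `w ⊢ a`. -/
def interiorForm (w : Multivector n M) (a : Form n M) : Form n M := fun x => interiorMul (w x) (a x)

/-- Koszul's operator `δ a = w ⊢ d a - d (w ⊢ a)`. -/
def koszul (w : Multivector n M) (a : Form n M) : Form n M :=
  interiorForm w (extD a) - extD (interiorForm w a)

/-! ### The quantum calculus

The module of polynomials `∑ h^p a_p` (`p ∈ ℕ`), respectively of Laurent polynomials (`p ∈ ℤ`), is
`Γ →₀ Form n M` with `Γ = ℕ`, respectively `Γ = ℤ`; the value at `p` is the coefficient of `h^p`. -/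

variable {Γ : Type*} [AddCommMonoidWithOne Γ]

/-- The quantum exterior product `∧_h`, fiberwise, extended bilinearly over `ℝ[h]`,
respectively `ℝ[h, h⁻¹]`. The terms with `r > n` vanish. -/
def quantumWedge (w : Multivector n M) (α β : Γ →₀ Form n M) : Γ →₀ Form n M :=
  α.sum fun p a => β.sum fun q b => ∑ r ∈ Finset.range (n + 1),
    Finsupp.single (p + q + (r : Γ)) fun x => quantumCoeff (w x) r (a x) (b x)

/-- The quantum exterior differential `d_h = d - h δ`. -/
def quantumD (w : Multivector n M) (α : Γ →₀ Form n M) : Γ →₀ Form n M :=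
  α.sum fun p a => Finsupp.single p (extD a) - Finsupp.single (p + 1) (koszul w a)

/-- `α` is homogeneous of degree `m`, where `h` has degree `2`: if the coefficient of `h^p` is not
zero, then it is a `k`-form with `k + 2 p = m`. -/
def HasDegree (α : Γ →₀ Form n M) (m : Γ) : Prop :=
  ∀ p ∈ α.support, ∃ k : ℕ, (k : Γ) + 2 • p = m ∧ (α p).IsHomogeneous k

end Manifolds

end QuantumDeRham

end

/-!
Write `L = w ⊢` and `Tᵣ(α, β) = ∑ w^{i₁j₁} ⋯ w^{iᵣjᵣ} (α ⊣ e_{i₁} ⊣ ⋯) ∧ (⋯ ⊢ e_{j₁} ⊢ β)`, so that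
`α ∧_h β = ∑ hʳ/r! Tᵣ(α, β)`.

For a bivector `w` the operator `L` has order two on `Λ(V*)`, and `-T₁` is its deviation from a
derivation (`interiorMul_mul`). As `L` commutes with all contractions, this gives the recursion
`Tᵣ₊₁(α, β) = Tᵣ(Lα, β) + Tᵣ(α, Lβ) - L Tᵣ(α, β)` (`contractedWedge_succ`). In other words
`α ∧_h β = e^{-hL}(e^{hL}α ∧ e^{hL}β)`: the quantum product is the exterior product conjugated by
`e^{hL}`. Conjugating `d` in the same way gives `d - h[L, d] + h²/2 [L, [L, d]] - ⋯`, whose first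
two terms are `d_h` because `δ = [L, d]`. The higher terms vanish on a Poisson manifold:
`[L, [L, d]]` is a tensorial operator, the interior product with `-[w, w]`
(`interiorMul_localSchouten`, `interiorForm_koszul`). So `d_h` is an antiderivation of `∧_h`
because `d` is one of `∧`.

The exponentials are replaced by induction on the power of `h` (`extD_wedgeForm`), using the recursion
for `Tᵣ` and `Lδ = δL`. Only exterior derivatives of smooth forms enter, and each is evaluated at
the point `p` in the chart around `p` in which `extD` is defined, so neither `d² = 0` nor the
independence of `d` from the chart is needed. The sign `(-1)^{|α|}` is carried by the grade
involution, with which `L` commutes.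
-/

noncomputable section

namespace QuantumDeRham

/-! ### Contractions in the exterior algebra -/

section ExteriorAlgebra

variable {U : Type*} [AddCommGroup U] [Module ℝ U]

theorem ι_mul_eq_involute_mul_ι (u : U) (x : ExteriorAlgebra ℝ U) :
    ExteriorAlgebra.ι ℝ u * x = CliffordAlgebra.involute x * ExteriorAlgebra.ι ℝ u := by
  induction x using CliffordAlgebra.left_induction with
  | algebraMap r => rw [AlgHom.commutes, Algebra.commutes]
  | add x y hx hy => rw [mul_add, map_add, add_mul, hx, hy]
  | ι_mul x v hx =>
    have h := eq_neg_of_add_eq_zero_left (ExteriorAlgebra.ι_add_mul_swap (R := ℝ) u v)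
    rw [map_mul, CliffordAlgebra.involute_ι, mul_assoc, ← hx, ← mul_assoc, ← mul_assoc, neg_mul]
    exact congrArg (· * x) h

theorem involute_contractLeft (d : Module.Dual ℝ U) (x : ExteriorAlgebra ℝ U) :
    CliffordAlgebra.involute (CliffordAlgebra.contractLeft d x) =
      -CliffordAlgebra.contractLeft d (CliffordAlgebra.involute x) := by
  induction x using CliffordAlgebra.left_induction with
  | algebraMap r => simp
  | add x y hx hy => simp only [map_add, hx, hy, neg_add]
  | ι_mul x v hx =>
    simp only [CliffordAlgebra.contractLeft_ι_mul, map_sub, map_smul, map_mul,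
      CliffordAlgebra.involute_ι, neg_mul, map_neg, hx]
    simp

/-- The contraction with a covector is an antiderivation. -/
theorem contractLeft_mul (d : Module.Dual ℝ U) (x y : ExteriorAlgebra ℝ U) :
    CliffordAlgebra.contractLeft d (x * y) = CliffordAlgebra.contractLeft d x * y +
      CliffordAlgebra.involute x * CliffordAlgebra.contractLeft d y := by
  induction x using CliffordAlgebra.left_induction with
  | algebraMap r => simp [CliffordAlgebra.contractLeft_algebraMap_mul]
  | add x z hx hz => simp only [map_add, add_mul, hx, hz]; abel
  | ι_mul x v hx =>
    simp only [mul_assoc, CliffordAlgebra.contractLeft_ι_mul, map_mul, hx, sub_mul, mul_add,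
      CliffordAlgebra.involute_ι, neg_mul, smul_mul_assoc]
    abel

theorem contractRight_eq_involute (d : Module.Dual ℝ U) (x : ExteriorAlgebra ℝ U) :
    CliffordAlgebra.contractRight x d =
      CliffordAlgebra.involute (CliffordAlgebra.contractLeft d x) := by
  induction x using CliffordAlgebra.right_induction with
  | algebraMap r => simp
  | add x y hx hy => simp only [map_add, LinearMap.add_apply, hx, hy]
  | mul_ι v x hx =>
    rw [CliffordAlgebra.contractRight_mul_ι, hx, contractLeft_mul, map_add, map_mul, map_mul,
      CliffordAlgebra.involute_involute, CliffordAlgebra.involute_ι,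
      CliffordAlgebra.contractLeft_ι, AlgHom.commutes, ← Algebra.commutes, ← Algebra.smul_def]
    simp only [mul_neg]
    abel

theorem contractLeft_map {U' : Type*} [AddCommGroup U'] [Module ℝ U'] (f : U →ₗ[ℝ] U')
    (d : Module.Dual ℝ U') (x : ExteriorAlgebra ℝ U) :
    CliffordAlgebra.contractLeft d (ExteriorAlgebra.map f x) =
      ExteriorAlgebra.map f (CliffordAlgebra.contractLeft (d ∘ₗ f) x) := by
  induction x using CliffordAlgebra.left_induction with
  | algebraMap r => simp
  | add x y hx hy => simp only [map_add, hx, hy]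
  | ι_mul x v hx =>
    have h : ExteriorAlgebra.map f (CliffordAlgebra.ι 0 v) = CliffordAlgebra.ι 0 (f v) :=
      ExteriorAlgebra.map_apply_ι f v
    simp only [map_mul, CliffordAlgebra.contractLeft_ι_mul, map_sub, map_smul, h, hx,
      LinearMap.comp_apply]

theorem involute_map {U' : Type*} [AddCommGroup U'] [Module ℝ U'] (f : U →ₗ[ℝ] U')
    (x : ExteriorAlgebra ℝ U) :
    CliffordAlgebra.involute (ExteriorAlgebra.map f x) =
      ExteriorAlgebra.map f (CliffordAlgebra.involute x) := by
  induction x using CliffordAlgebra.left_induction with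
  | algebraMap r => simp
  | add x y hx hy => simp only [map_add, hx, hy]
  | ι_mul x v hx =>
    have h : ExteriorAlgebra.map f (CliffordAlgebra.ι 0 v) = CliffordAlgebra.ι 0 (f v) :=
      ExteriorAlgebra.map_apply_ι f v
    simp only [map_mul, h, hx, CliffordAlgebra.involute_ι, map_neg]

theorem involute_of_mem_exteriorPower {k : ℕ} {x : ExteriorAlgebra ℝ U} (hx : x ∈ ⋀[ℝ]^k U) :
    CliffordAlgebra.involute x = (-1 : ℝ) ^ k • x := by
  induction hx using Submodule.pow_induction_on_left' with
  | algebraMap r => simp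
  | add x y i _ _ hx hy => rw [map_add, hx, hy, smul_add]
  | mem_mul m hm i x _ hx =>
    obtain ⟨u, rfl⟩ := hm
    have h : CliffordAlgebra.involute (ExteriorAlgebra.ι ℝ u) = -ExteriorAlgebra.ι ℝ u :=
      CliffordAlgebra.involute_ι u
    rw [map_mul, h, hx, pow_succ]
    simp

/-- Bivectors are sums of decomposable ones. -/
theorem bivector_induction {p : ExteriorAlgebra ℝ U → Prop} {w : ExteriorAlgebra ℝ U}
    (hw : w ∈ ⋀[ℝ]^2 U) (add : ∀ x y, p x → p y → p (x + y))
    (mul : ∀ u v : U, p (ExteriorAlgebra.ι ℝ u * ExteriorAlgebra.ι ℝ v)) : p w := by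
  rw [ExteriorAlgebra.exteriorPower, pow_two] at hw
  refine Submodule.mul_induction_on hw ?_ add
  rintro _ ⟨u, rfl⟩ _ ⟨v, rfl⟩
  exact mul u v

theorem bivector_commute {w : ExteriorAlgebra ℝ U} (hw : w ∈ ⋀[ℝ]^2 U)
    (x : ExteriorAlgebra ℝ U) : w * x = x * w := by
  refine bivector_induction (p := fun w => w * x = x * w) hw ?_ ?_
  · intro y z hy hz; rw [add_mul, mul_add, hy, hz]
  · intro u v
    rw [mul_assoc, ι_mul_eq_involute_mul_ι v, ← mul_assoc, ι_mul_eq_involute_mul_ι u,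
      CliffordAlgebra.involute_involute, mul_assoc]

theorem contractLeft_bivector {w : ExteriorAlgebra ℝ U} (hw : w ∈ ⋀[ℝ]^2 U)
    (d : Module.Dual ℝ U) :
    CliffordAlgebra.contractLeft d w = -CliffordAlgebra.contractRight w d := by
  rw [contractRight_eq_involute, involute_contractLeft, involute_of_mem_exteriorPower hw]
  simp

end ExteriorAlgebra

section InteriorProduct

universe u

variable {V : Type u} [AddCommGroup V] [Module ℝ V]

theorem contrR_eq_involute (α : DualExt V) (v : V) :
    contrR α v = CliffordAlgebra.involute (contrL v α) :=
  contractRight_eq_involute _ _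

@[simp]
theorem interiorMul_ι (v : V) : interiorMul (ExteriorAlgebra.ι ℝ v) = contrL v :=
  ExteriorAlgebra.lift_ι_apply ℝ _ _ v

theorem interiorMul_ι_mul_ι (u v : V) (α : DualExt V) :
    interiorMul (ExteriorAlgebra.ι ℝ u * ExteriorAlgebra.ι ℝ v) α = contrL u (contrL v α) := by
  rw [map_mul, interiorMul_ι, interiorMul_ι]; rfl

theorem contrL_mul (v : V) (α β : DualExt V) :
    contrL v (α * β) = contrL v α * β + CliffordAlgebra.involute α * contrL v β :=
  contractLeft_mul _ _ _

theorem involute_contrL (v : V) (α : DualExt V) :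
    CliffordAlgebra.involute (contrL v α) = -contrL v (CliffordAlgebra.involute α) :=
  involute_contractLeft _ _

variable {w : ExteriorAlgebra ℝ V}

theorem involute_interiorMul (hw : w ∈ ⋀[ℝ]^2 V) (α : DualExt V) :
    CliffordAlgebra.involute (interiorMul w α) = interiorMul w (CliffordAlgebra.involute α) := by
  refine bivector_induction (p := fun w => CliffordAlgebra.involute (interiorMul w α) =
    interiorMul w (CliffordAlgebra.involute α)) hw ?_ ?_
  · intro x y hx hy; simp only [map_add, LinearMap.add_apply, hx, hy]
  · intro u v
    simp only [interiorMul_ι_mul_ι, involute_contrL, map_neg, neg_neg]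

theorem interiorMul_interiorMul_comm (hw : w ∈ ⋀[ℝ]^2 V) (x : ExteriorAlgebra ℝ V)
    (α : DualExt V) :
    interiorMul w (interiorMul x α) = interiorMul x (interiorMul w α) := by
  rw [← Module.End.mul_apply, ← map_mul, bivector_commute hw, map_mul, Module.End.mul_apply]

theorem interiorMul_contrL (hw : w ∈ ⋀[ℝ]^2 V) (v : V) (α : DualExt V) :
    interiorMul w (contrL v α) = contrL v (interiorMul w α) := by
  rw [← interiorMul_ι, interiorMul_interiorMul_comm hw]

theorem interiorMul_contrR (hw : w ∈ ⋀[ℝ]^2 V) (v : V) (α : DualExt V) :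
    interiorMul w (contrR α v) = contrR (interiorMul w α) v := by
  rw [contrR_eq_involute, contrR_eq_involute, ← involute_interiorMul hw, interiorMul_contrL hw]

/-- The commutator of `w ⊢` with the exterior product by a covector `ξ` is the contraction with the
vector `w ⌊ ξ`. -/
theorem interiorMul_ι_mul (hw : w ∈ ⋀[ℝ]^2 V) (ξ : Module.Dual ℝ V) (α : DualExt V) :
    interiorMul w (ExteriorAlgebra.ι ℝ ξ * α) = ExteriorAlgebra.ι ℝ ξ * interiorMul w α +
      interiorMul (CliffordAlgebra.contractRight w ξ) α := by
  refine bivector_induction (p := fun w => interiorMul w (ExteriorAlgebra.ι ℝ ξ * α) =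
    ExteriorAlgebra.ι ℝ ξ * interiorMul w α +
      interiorMul (CliffordAlgebra.contractRight w ξ) α) hw ?_ ?_
  · intro x y hx hy
    simp only [map_add, LinearMap.add_apply, hx, hy, mul_add]
    abel
  · intro u v
    have h (v : V) (γ : DualExt V) : contrL v (ExteriorAlgebra.ι ℝ ξ * γ) =
        ξ v • γ - ExteriorAlgebra.ι ℝ ξ * contrL v γ :=
      CliffordAlgebra.contractLeft_ι_mul _ _ _
    have h' : CliffordAlgebra.contractRight
        (ExteriorAlgebra.ι ℝ u * ExteriorAlgebra.ι ℝ v) ξ =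
        ξ v • ExteriorAlgebra.ι ℝ u - ξ u • ExteriorAlgebra.ι ℝ v := by
      refine (CliffordAlgebra.contractRight_mul_ι _ _ _).trans ?_
      erw [CliffordAlgebra.contractRight_ι]
      rw [← Algebra.smul_def]
    simp only [interiorMul_ι_mul_ι, h, h', map_sub, map_smul, interiorMul_ι, LinearMap.sub_apply,
      LinearMap.smul_apply]
    abel

theorem component_ι_mul_ι (u v : V) (ξ η : Module.Dual ℝ V) :
    component (ExteriorAlgebra.ι ℝ u * ExteriorAlgebra.ι ℝ v) ξ η = ξ u * η v - ξ v * η u := by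
  have h : CliffordAlgebra.contractLeft ξ (ExteriorAlgebra.ι ℝ u * ExteriorAlgebra.ι ℝ v) =
      ξ u • ExteriorAlgebra.ι ℝ v - ξ v • ExteriorAlgebra.ι ℝ u := by
    refine (CliffordAlgebra.contractLeft_ι_mul _ _ _).trans ?_
    erw [CliffordAlgebra.contractLeft_ι]
    rw [← Algebra.commutes, ← Algebra.smul_def]
  have h' (v : V) : CliffordAlgebra.contractLeft η (ExteriorAlgebra.ι ℝ v) =
      algebraMap ℝ _ (η v) := CliffordAlgebra.contractLeft_ι _ _ _
  rw [component, h, map_sub, map_smul, map_smul, h', h']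
  simp only [map_sub, map_smul, ExteriorAlgebra.algebraMap_leftInverse V _, smul_eq_mul]

/-- `w ⊢` is a second order operator on `Λ(V*)`, and `-∑ w^{ij} (α ⊣ e_i) ∧ (e_j ⊢ β)` is its
deviation from being a derivation. -/
theorem interiorMul_mul (hw : w ∈ ⋀[ℝ]^2 V) {ι : Type*} [Fintype ι]
    (e : Module.Basis ι ℝ V) (α β : DualExt V) :
    ∑ i, ∑ j, component w (e.coord i) (e.coord j) • (contrR α (e i) * contrL (e j) β) =
      interiorMul w α * β + α * interiorMul w β - interiorMul w (α * β) := by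
  refine bivector_induction (p := fun w =>
    ∑ i, ∑ j, component w (e.coord i) (e.coord j) • (contrR α (e i) * contrL (e j) β) =
      interiorMul w α * β + α * interiorMul w β - interiorMul w (α * β)) hw ?_ ?_
  · intro x y hx hy
    simp only [component, map_add, add_smul, Finset.sum_add_distrib, LinearMap.add_apply, add_mul,
      mul_add] at hx hy ⊢
    rw [hx, hy]
    abel
  · intro u v
    have key (u v : V) : ∑ i, ∑ j, (e.coord i u * e.coord j v) •
        (contrR α (e i) * contrL (e j) β) = contrR α u * contrL v β := by
      have h1 : contrR α u = ∑ i, e.coord i u • contrR α (e i) := by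
        conv_lhs => rw [← e.sum_repr u]
        simp only [contrR, map_sum, map_smul, e.coord_apply]
      have h2 : contrL v β = ∑ j, e.coord j v • contrL (e j) β := by
        conv_lhs => rw [← e.sum_repr v]
        simp only [map_sum, map_smul, LinearMap.sum_apply, LinearMap.smul_apply, e.coord_apply]
      rw [h1, h2, Finset.sum_mul_sum]
      simp only [smul_mul_smul_comm]
    simp only [component_ι_mul_ι, sub_smul, Finset.sum_sub_distrib]
    rw [key]
    have key' : ∑ i, ∑ j, (e.coord i v * e.coord j u) • (contrR α (e i) * contrL (e j) β) =
      contrR α v * contrL u β := key v u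
    rw [key']
    simp only [interiorMul_ι_mul_ι, contrL_mul, map_add, contrR_eq_involute, involute_contrL,
      CliffordAlgebra.involute_involute, neg_mul]
    abel

end InteriorProduct

section ContractedWedge

universe u

variable {V : Type u} [AddCommGroup V] [Module ℝ V] {ι : Type*} [Fintype ι]
  (e : Module.Basis ι ℝ V) (w : ExteriorAlgebra ℝ V)

theorem contractedWedge_add_left (r : ℕ) (α α' β : DualExt V) :
    contractedWedge e w r (α + α') β =
      contractedWedge e w r α β + contractedWedge e w r α' β := by
  induction r generalizing α α' β with
  | zero => exact add_mul _ _ _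
  | succ r ih =>
    simp only [contractedWedge, contrR, map_add, LinearMap.add_apply] at ih ⊢
    simp only [ih, smul_add, Finset.sum_add_distrib]

theorem contractedWedge_add_right (r : ℕ) (α β β' : DualExt V) :
    contractedWedge e w r α (β + β') =
      contractedWedge e w r α β + contractedWedge e w r α β' := by
  induction r generalizing α β β' with
  | zero => exact mul_add _ _ _
  | succ r ih => simp only [contractedWedge, map_add, ih, smul_add, Finset.sum_add_distrib]

variable {w} in
/-- The recursion that characterizes the iterated contractions: `∑ hʳ/r! Tᵣ(α, β)` is the
exterior product conjugated by `exp (h w ⊢)`. -/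
theorem contractedWedge_succ (hw : w ∈ ⋀[ℝ]^2 V) (r : ℕ) (α β : DualExt V) :
    contractedWedge e w (r + 1) α β = contractedWedge e w r (interiorMul w α) β +
      contractedWedge e w r α (interiorMul w β) - interiorMul w (contractedWedge e w r α β) := by
  induction r generalizing α β with
  | zero => exact interiorMul_mul hw e α β
  | succ r ih =>
    have E (α β : DualExt V) : contractedWedge e w (r + 1) α β =
        ∑ i, ∑ j, component w (e.coord i) (e.coord j) •
          contractedWedge e w r (contrR α (e i)) (contrL (e j) β) := rfl
    rw [contractedWedge, E _ β, E α _, E α β]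
    simp only [ih, interiorMul_contrL hw, interiorMul_contrR hw, smul_sub, smul_add,
      Finset.sum_sub_distrib, Finset.sum_add_distrib, map_sum, map_smul]

theorem exteriorPower_eq_bot [Module.Finite ℝ V] {k : ℕ} (hk : Module.finrank ℝ V < k) :
    ⋀[ℝ]^k V = ⊥ := by
  apply Submodule.finrank_eq_zero.1
  rw [exteriorPower.finrank_eq, Nat.choose_eq_zero_of_lt hk]

/-- Contracting with more than `dim V` vectors gives zero. -/
theorem contractedWedge_eq_zero [Module.Finite ℝ V] {r : ℕ} (hr : Module.finrank ℝ V < r)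
    (α β : DualExt V) : contractedWedge e w r α β = 0 := by
  -- The contractions already applied to `β` are collected in a multivector `P` of degree `s`.
  suffices h : ∀ r s : ℕ, Module.finrank ℝ V < r + s → ∀ P ∈ ⋀[ℝ]^s V, ∀ α β : DualExt V,
      contractedWedge e w r α (interiorMul P β) = 0 by
    have h1 := h r 0 hr 1 (by simp) α β
    rwa [map_one, Module.End.one_apply] at h1
  intro r
  induction r with
  | zero =>
    intro s hs P hP α β
    rw [exteriorPower_eq_bot (by omega), Submodule.mem_bot] at hP
    rw [hP, map_zero, contractedWedge, LinearMap.zero_apply, mul_zero]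
  | succ r ih =>
    intro s hs P hP α β
    rw [contractedWedge]
    refine Finset.sum_eq_zero fun i _ => Finset.sum_eq_zero fun j _ => ?_
    rw [← interiorMul_ι, ← Module.End.mul_apply, ← map_mul, ih (s + 1) (by omega), smul_zero]
    rw [ExteriorAlgebra.exteriorPower, pow_succ']
    exact Submodule.mul_mem_mul ⟨_, rfl⟩ hP

end ContractedWedge

/-! ### Componentwise calculus -/

section Calculus

open scoped Topology

variable {n : ℕ} {W W₁ W₂ : Type*} [AddCommGroup W] [Module ℝ W] [AddCommGroup W₁] [Module ℝ W₁]
  [AddCommGroup W₂] [Module ℝ W₂]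

/-- All the components of `f` are differentiable at `y`. -/
def ComponentsDifferentiableAt (f : Model n → W) (y : Model n) : Prop :=
  ∀ l : Module.Dual ℝ W, DifferentiableAt ℝ (fun z => l (f z)) y

theorem SmoothOn.componentsDifferentiableAt {f : Model n → W} {s : Set (Model n)}
    (hf : SmoothOn f s) (hs : IsOpen s) {y : Model n} (hy : y ∈ s) :
    ComponentsDifferentiableAt f y := fun l =>
  ((hf l).differentiableOn (by simp)).differentiableAt (hs.mem_nhds hy)

theorem SmoothOn.congr {f g : Model n → W} {s : Set (Model n)} (hf : SmoothOn f s)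
    (h : ∀ y ∈ s, g y = f y) : SmoothOn g s := fun l =>
  (hf l).congr fun y hy => congrArg l (h y hy)

theorem SmoothOn.add {f g : Model n → W} {s : Set (Model n)} (hf : SmoothOn f s)
    (hg : SmoothOn g s) : SmoothOn (fun y => f y + g y) s := fun l => by
  simpa only [map_add] using (hf l).add (hg l)

theorem SmoothOn.const_smul {f : Model n → W} {s : Set (Model n)} (c : ℝ) (hf : SmoothOn f s) :
    SmoothOn (fun y => c • f y) s := fun l => by
  simpa only [map_smul] using (hf l).const_smul c

theorem eq_of_forall_dual_eq {a b : W} (h : ∀ l : Module.Dual ℝ W, l a = l b) : a = b :=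
  sub_eq_zero.1 <| (Module.forall_dual_apply_eq_zero_iff ℝ _).1 fun l => by
    rw [map_sub, h, sub_self]

theorem dual_bilin_eq_sum [Module.Finite ℝ W₁] [Module.Finite ℝ W₂] (B : W₁ →ₗ[ℝ] W₂ →ₗ[ℝ] W)
    (l : Module.Dual ℝ W) (a : W₁) (b : W₂) :
    l (B a b) = ∑ k, ∑ j, (Module.finBasis ℝ W₁).coord k a * (Module.finBasis ℝ W₂).coord j b *
      l (B (Module.finBasis ℝ W₁ k) (Module.finBasis ℝ W₂ j)) := by
  conv_lhs => rw [← (Module.finBasis ℝ W₁).sum_repr a, ← (Module.finBasis ℝ W₂).sum_repr b]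
  simp only [map_sum, map_smul, LinearMap.sum_apply, LinearMap.smul_apply, smul_eq_mul,
    Module.Basis.coord_apply, Finset.mul_sum, mul_assoc]
  rw [Finset.sum_comm]
  exact Finset.sum_congr rfl fun k _ => Finset.sum_congr rfl fun j _ => by ring

theorem SmoothOn.bilin [Module.Finite ℝ W₁] [Module.Finite ℝ W₂] (B : W₁ →ₗ[ℝ] W₂ →ₗ[ℝ] W)
    {f : Model n → W₁} {g : Model n → W₂} {s : Set (Model n)} (hf : SmoothOn f s)
    (hg : SmoothOn g s) : SmoothOn (fun y => B (f y) (g y)) s := fun l => by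
  rw [show (fun y => l (B (f y) (g y))) = _ from funext fun y => dual_bilin_eq_sum B l _ _]
  exact ContDiffOn.sum fun k _ => ContDiffOn.sum fun j _ =>
    ((hf _).mul (hg _)).mul contDiffOn_const

theorem dual_pderiv [Module.Finite ℝ W] (i : Fin n) {f : Model n → W} {y : Model n}
    (hf : ComponentsDifferentiableAt f y) (l : Module.Dual ℝ W) :
    l (pderiv i f y) = fderiv ℝ (fun z => l (f z)) y (EuclideanSpace.single i 1) := by
  have h : (fun z => l (f z)) = fun z => ∑ k, (Module.finBasis ℝ W).coord k (f z) *
      l (Module.finBasis ℝ W k) := by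
    funext z
    conv_lhs => rw [← (Module.finBasis ℝ W).sum_repr (f z)]
    simp only [map_sum, map_smul, smul_eq_mul, Module.Basis.coord_apply]
  rw [h, fderiv_fun_sum fun k _ => (hf _).mul_const _]
  simp only [pderiv, map_sum, map_smul, smul_eq_mul, sum_apply]
  refine Finset.sum_congr rfl fun k _ => ?_
  rw [fderiv_mul_const (hf _)]
  simp [mul_comm]

theorem pderiv_congr [Module.Finite ℝ W] (i : Fin n) {f g : Model n → W} {y : Model n}
    (h : f =ᶠ[𝓝 y] g) : pderiv i f y = pderiv i g y := by
  refine Finset.sum_congr rfl fun k _ => ?_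
  have hk : (fun z => (Module.finBasis ℝ W).coord k (f z)) =ᶠ[𝓝 y]
      fun z => (Module.finBasis ℝ W).coord k (g z) := h.fun_comp _
  rw [hk.fderiv_eq]

theorem ComponentsDifferentiableAt.bilin [Module.Finite ℝ W₁] [Module.Finite ℝ W₂]
    (B : W₁ →ₗ[ℝ] W₂ →ₗ[ℝ] W) {f : Model n → W₁} {g : Model n → W₂} {y : Model n}
    (hf : ComponentsDifferentiableAt f y) (hg : ComponentsDifferentiableAt g y) :
    ComponentsDifferentiableAt (fun z => B (f z) (g z)) y := fun l => by
  rw [show (fun y => l (B (f y) (g y))) = _ from funext fun y => dual_bilin_eq_sum B l _ _]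
  exact DifferentiableAt.fun_sum fun k _ => DifferentiableAt.fun_sum fun j _ =>
    ((hf _).mul (hg _)).mul_const _

/-- The Leibniz rule for partial derivatives. -/
theorem pderiv_bilin [Module.Finite ℝ W] [Module.Finite ℝ W₁] [Module.Finite ℝ W₂]
    (B : W₁ →ₗ[ℝ] W₂ →ₗ[ℝ] W) (i : Fin n) {f : Model n → W₁} {g : Model n → W₂} {y : Model n}
    (hf : ComponentsDifferentiableAt f y) (hg : ComponentsDifferentiableAt g y) :
    pderiv i (fun z => B (f z) (g z)) y = B (pderiv i f y) (g y) + B (f y) (pderiv i g y) := by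
  refine eq_of_forall_dual_eq fun l => ?_
  rw [dual_pderiv i (hf.bilin B hg), map_add]
  rw [show (fun y => l (B (f y) (g y))) = _ from funext fun y => dual_bilin_eq_sum B l _ _,
    dual_bilin_eq_sum B l (pderiv i f y), dual_bilin_eq_sum B l (f y)]
  have hd (k) (j) : DifferentiableAt ℝ (fun z => (Module.finBasis ℝ W₁).coord k (f z) *
      (Module.finBasis ℝ W₂).coord j (g z) *
      l (B (Module.finBasis ℝ W₁ k) (Module.finBasis ℝ W₂ j))) y :=
    ((hf _).mul (hg _)).mul_const _
  rw [fderiv_fun_sum fun k _ => DifferentiableAt.fun_sum fun j _ => hd k j]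
  simp only [sum_apply, ← Finset.sum_add_distrib]
  refine Finset.sum_congr rfl fun k _ => ?_
  rw [fderiv_fun_sum fun j _ => hd k j]
  simp only [sum_apply]
  refine Finset.sum_congr rfl fun j _ => ?_
  rw [fderiv_mul_const ((hf _).fun_mul (hg _)), fderiv_fun_mul (hf _) (hg _), dual_pderiv i hf,
    dual_pderiv i hg]
  simp only [smul_apply, add_apply, smul_eq_mul]
  ring

theorem pderiv_linear [Module.Finite ℝ W] [Module.Finite ℝ W₁] (A : W₁ →ₗ[ℝ] W) (i : Fin n)
    {f : Model n → W₁} {y : Model n} (hf : ComponentsDifferentiableAt f y) :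
    pderiv i (fun z => A (f z)) y = A (pderiv i f y) := by
  refine eq_of_forall_dual_eq fun l => ?_
  rw [dual_pderiv i (fun l => hf (l ∘ₗ A))]
  exact (dual_pderiv i hf (l ∘ₗ A)).symm

theorem pderiv_add [Module.Finite ℝ W] (i : Fin n) {f g : Model n → W} {y : Model n}
    (hf : ComponentsDifferentiableAt f y) (hg : ComponentsDifferentiableAt g y) :
    pderiv i (fun z => f z + g z) y = pderiv i f y + pderiv i g y := by
  refine eq_of_forall_dual_eq fun l => ?_
  rw [dual_pderiv i (fun l => by simpa only [map_add] using (hf l).fun_add (hg l)), map_add,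
    dual_pderiv i hf, dual_pderiv i hg]
  simp only [map_add]
  rw [fderiv_fun_add (hf l) (hg l)]
  rfl

theorem pderiv_smul [Module.Finite ℝ W] (i : Fin n) (c : ℝ) {f : Model n → W} {y : Model n}
    (hf : ComponentsDifferentiableAt f y) :
    pderiv i (fun z => c • f z) y = c • pderiv i f y :=
  pderiv_linear (LinearMap.lsmul ℝ W c) i hf

end Calculus

/-! ### The exterior derivative and the Schouten bracket in coordinates -/

section Local

open scoped Topology

variable {n : ℕ} {y : Model n}

variable (n) in
/-- The exterior product of forms as a bilinear map. -/
def mulBilin : DualExt (Model n) →ₗ[ℝ] DualExt (Model n) →ₗ[ℝ] DualExt (Model n) :=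
  LinearMap.mul ℝ (DualExt (Model n))

theorem mulBilin_apply (a b : DualExt (Model n)) : mulBilin n a b = a * b := rfl

variable (n) in
/-- The interior product as a bilinear map. -/
def interiorBilin :
    ExteriorAlgebra ℝ (Model n) →ₗ[ℝ] DualExt (Model n) →ₗ[ℝ] DualExt (Model n) :=
  interiorMul.toLinearMap

theorem localExtDeriv_congr {f g : Model n → DualExt (Model n)} (h : f =ᶠ[𝓝 y] g) :
    localExtDeriv f y = localExtDeriv g y :=
  Finset.sum_congr rfl fun i _ => by rw [pderiv_congr i h]

theorem localExtDeriv_add {f g : Model n → DualExt (Model n)}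
    (hf : ComponentsDifferentiableAt f y) (hg : ComponentsDifferentiableAt g y) :
    localExtDeriv (fun z => f z + g z) y = localExtDeriv f y + localExtDeriv g y := by
  simp only [localExtDeriv, pderiv_add _ hf hg, mul_add, Finset.sum_add_distrib]

theorem localExtDeriv_smul (c : ℝ) {f : Model n → DualExt (Model n)}
    (hf : ComponentsDifferentiableAt f y) :
    localExtDeriv (fun z => c • f z) y = c • localExtDeriv f y := by
  simp only [localExtDeriv, pderiv_smul _ c hf, mul_smul_comm, Finset.smul_sum]

theorem localExtDeriv_mul {f g : Model n → DualExt (Model n)}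
    (hf : ComponentsDifferentiableAt f y) (hg : ComponentsDifferentiableAt g y) :
    localExtDeriv (fun z => f z * g z) y =
      localExtDeriv f y * g y + CliffordAlgebra.involute (f y) * localExtDeriv g y := by
  have h (i : Fin n) : pderiv i (fun z => f z * g z) y =
      pderiv i f y * g y + f y * pderiv i g y := by
    simpa only [mulBilin_apply] using pderiv_bilin (mulBilin n) i hf hg
  simp only [localExtDeriv, h, mul_add, Finset.sum_add_distrib, Finset.sum_mul, Finset.mul_sum,
    mul_assoc, ← mul_assoc _ (f y), ι_mul_eq_involute_mul_ι _ (f y)]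

/-- The Schouten bracket `[W, W]` of a bivector field acts on forms as minus the double commutator
of `W ⊢` with the exterior derivative: the derivatives of `f` cancel. -/
theorem interiorMul_localSchouten {W : Model n → ExteriorAlgebra ℝ (Model n)}
    {f : Model n → DualExt (Model n)} {s : Set (Model n)} (hs : IsOpen s) (hy : y ∈ s)
    (hW2 : ∀ z ∈ s, W z ∈ ⋀[ℝ]^2 (Model n)) (hW : SmoothOn W s) (hf : SmoothOn f s) :
    interiorMul (W y) (interiorMul (W y) (localExtDeriv f y)) -
      (2 : ℝ) • interiorMul (W y) (localExtDeriv (fun z => interiorMul (W z) (f z)) y) +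
      localExtDeriv (fun z => interiorMul (W z) (interiorMul (W z) (f z))) y =
    -interiorMul (localSchouten W W y) (f y) := by
  have dW := hW.componentsDifferentiableAt hs hy
  have df := hf.componentsDifferentiableAt hs hy
  have dWf : ComponentsDifferentiableAt (fun z => interiorMul (W z) (f z)) y :=
    dW.bilin (interiorBilin n) df
  have h2 := hW2 y hy
  have hL (i : Fin n) {g : Model n → DualExt (Model n)} (hg : ComponentsDifferentiableAt g y) :
      pderiv i (fun z => interiorMul (W z) (g z)) y =
        interiorMul (pderiv i W y) (g y) + interiorMul (W y) (pderiv i g y) :=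
    pderiv_bilin (interiorBilin n) i dW hg
  -- `∂ᵢW` is even, because commuting with a fixed multivector is a linear condition.
  have hcomm (i : Fin n) (x : ExteriorAlgebra ℝ (Model n)) :
      pderiv i W y * x = x * pderiv i W y := by
    refine (pderiv_linear (LinearMap.mulRight ℝ x) i dW).symm.trans
      (Eq.trans (pderiv_congr i ?_) (pderiv_linear (LinearMap.mulLeft ℝ x) i dW))
    filter_upwards [hs.mem_nhds hy] with z hz
    exact bivector_commute (hW2 z hz) x
  have hS : localSchouten W W y = (2 : ℝ) •
      ∑ i, CliffordAlgebra.contractRight (W y) (dx i) * pderiv i W y := by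
    simp only [localSchouten, contractLeft_bivector h2, hcomm, Finset.smul_sum, two_smul, neg_mul,
      sub_neg_eq_add]
  simp only [localExtDeriv, hL _ df, hL _ dWf, map_sum, interiorMul_ι_mul h2, map_add, hS,
    map_smul, LinearMap.sum_apply, LinearMap.smul_apply, map_mul, Module.End.mul_apply,
    Finset.smul_sum, ← Finset.sum_sub_distrib, ← Finset.sum_add_distrib, ← Finset.sum_neg_distrib]
  refine Finset.sum_congr rfl fun i _ => ?_
  simp only [interiorMul_interiorMul_comm h2, mul_add, two_smul]
  abel

end Local

/-! ### Forms and bivector fields in charts -/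

section Naturality

universe u v

variable {V : Type u} [AddCommGroup V] [Module ℝ V] {V' : Type v} [AddCommGroup V'] [Module ℝ V']

/-- The projection formula for interior products: `P ⊢ A^* α = A^* (A_* P ⊢ α)`. -/
theorem interiorMul_map_dualMap (A : V →ₗ[ℝ] V') (P : ExteriorAlgebra ℝ V) (α : DualExt V') :
    interiorMul P (ExteriorAlgebra.map A.dualMap α) =
      ExteriorAlgebra.map A.dualMap (interiorMul (ExteriorAlgebra.map A P) α) := by
  induction P using CliffordAlgebra.left_induction generalizing α with
  | algebraMap r =>
    simp only [AlgHom.commutes, Module.algebraMap_end_apply, map_smul]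
  | add x y hx hy => simp only [map_add, LinearMap.add_apply, hx, hy]
  | ι_mul x v hx =>
    have h : interiorMul (CliffordAlgebra.ι 0 v) = contrL v := interiorMul_ι v
    have h' : ExteriorAlgebra.map A (CliffordAlgebra.ι 0 v) = ExteriorAlgebra.ι ℝ (A v) :=
      ExteriorAlgebra.map_apply_ι A v
    simp only [map_mul, Module.End.mul_apply, hx, h, h', interiorMul_ι]
    exact contractLeft_map A.dualMap (Module.Dual.eval ℝ V v) _

theorem map_map {V'' : Type*} [AddCommGroup V''] [Module ℝ V''] (A : V →ₗ[ℝ] V')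
    (B : V' →ₗ[ℝ] V'') (x : ExteriorAlgebra ℝ V) :
    ExteriorAlgebra.map B (ExteriorAlgebra.map A x) = ExteriorAlgebra.map (B ∘ₗ A) x := by
  rw [← ExteriorAlgebra.map_comp_map]; rfl

theorem map_mem_exteriorPower (A : V →ₗ[ℝ] V') {k : ℕ} {x : ExteriorAlgebra ℝ V}
    (hx : x ∈ ⋀[ℝ]^k V) : ExteriorAlgebra.map A x ∈ ⋀[ℝ]^k V' := by
  have h : (⋀[ℝ]^k V).map (ExteriorAlgebra.map A).toLinearMap ≤ ⋀[ℝ]^k V' := by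
    rw [ExteriorAlgebra.exteriorPower, Submodule.map_pow]
    refine pow_le_pow_left' ?_ k
    rintro _ ⟨_, ⟨v, rfl⟩, rfl⟩
    exact ⟨A v, (ExteriorAlgebra.map_apply_ι A v).symm⟩
  exact h ⟨x, hx, rfl⟩

end Naturality

section Charts

open scoped Topology

variable {n : ℕ} {M : Type*} [TopologicalSpace M] [ChartedSpace (Model n) M]

theorem Form.inChart_mul (a b : Form n M) (p : M) (y : Model n) :
    (a * b).inChart p y = a.inChart p y * b.inChart p y := map_mul _ _ _

theorem Form.inChart_add (a b : Form n M) (p : M) (y : Model n) :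
    (a + b).inChart p y = a.inChart p y + b.inChart p y := map_add _ _ _

theorem Form.inChart_smul (c : ℝ) (a : Form n M) (p : M) (y : Model n) :
    (c • a).inChart p y = c • a.inChart p y :=
  map_smul (ExteriorAlgebra.map _) c _

theorem Multivector.inChart_self (w : Multivector n M) (p : M) :
    w.inChart p (extChartAt (𝓡 n) p p) = ExteriorAlgebra.map (chartDiff p p) (w p) := by
  rw [Multivector.inChart, extChartAt_to_inv]

theorem Form.IsSmooth.zero : (0 : Form n M).IsSmooth := fun p l => by
  have h : (fun y => l ((0 : Form n M).inChart p y)) = fun _ => 0 :=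
    funext fun y => by rw [Form.inChart, Pi.zero_apply, map_zero, map_zero]
  rw [h]
  exact contDiffOn_const

theorem Form.IsSmooth.add {a b : Form n M} (ha : a.IsSmooth) (hb : b.IsSmooth) :
    (a + b).IsSmooth := fun p =>
  ((ha p).add (hb p)).congr fun y _ => Form.inChart_add a b p y

theorem Form.IsSmooth.smul (c : ℝ) {a : Form n M} (ha : a.IsSmooth) : (c • a).IsSmooth := fun p =>
  ((ha p).const_smul c).congr fun y _ => Form.inChart_smul c a p y

theorem Form.IsSmooth.mul {a b : Form n M} (ha : a.IsSmooth) (hb : b.IsSmooth) :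
    (a * b).IsSmooth := fun p =>
  ((ha p).bilin (mulBilin n) (hb p)).congr fun y _ => Form.inChart_mul a b p y

theorem Form.IsSmooth.differentiableAt {a : Form n M} (ha : a.IsSmooth) (p : M) :
    ComponentsDifferentiableAt (a.inChart p) (extChartAt (𝓡 n) p p) :=
  (ha p).componentsDifferentiableAt (isOpen_extChartAt_target p) (mem_extChartAt_target p)

theorem interiorForm_add (w : Multivector n M) (a b : Form n M) :
    interiorForm w (a + b) = interiorForm w a + interiorForm w b :=
  funext fun x => map_add (interiorMul (w x)) _ _

theorem interiorForm_smul (w : Multivector n M) (c : ℝ) (a : Form n M) :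
    interiorForm w (c • a) = c • interiorForm w a :=
  funext fun x => map_smul (interiorMul (w x)) _ _

theorem extD_add {a b : Form n M} (ha : a.IsSmooth) (hb : b.IsSmooth) :
    extD (a + b) = extD a + extD b := by
  funext p
  have h : (a + b).inChart p = fun y => a.inChart p y + b.inChart p y :=
    funext fun y => Form.inChart_add a b p y
  rw [Pi.add_apply, extD, h, localExtDeriv_add (ha.differentiableAt p) (hb.differentiableAt p),
    map_add]
  rfl

theorem extD_smul (c : ℝ) {a : Form n M} (ha : a.IsSmooth) : extD (c • a) = c • extD a := by
  funext p
  have h : (c • a).inChart p = fun y => c • a.inChart p y :=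
    funext fun y => Form.inChart_smul c a p y
  rw [Pi.smul_apply, extD, h, localExtDeriv_smul c (ha.differentiableAt p), map_smul]
  rfl

theorem interiorMul_map_chartDiff (w : Multivector n M) (p : M) (g : DualExt (Model n)) :
    interiorMul (w p) (ExteriorAlgebra.map (chartDiff p p).dualMap g) =
      ExteriorAlgebra.map (chartDiff p p).dualMap
        (interiorMul (w.inChart p (extChartAt (𝓡 n) p p)) g) := by
  rw [interiorMul_map_dualMap, Multivector.inChart_self]

variable [IsManifold (𝓡 n) ∞ M]

theorem chartDiffSymm_comp_chartDiff (p : M) {y : Model n}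
    (hy : y ∈ (extChartAt (𝓡 n) p).target) :
    chartDiffSymm p y ∘ₗ chartDiff p ((extChartAt (𝓡 n) p).symm y) = LinearMap.id := by
  have h := mfderivWithin_extChartAt_symm_comp_mfderiv_extChartAt hy
  rw [ModelWithCorners.range_eq_univ, mfderivWithin_univ] at h
  exact congrArg ContinuousLinearMap.toLinearMap h

theorem chartDiff_comp_chartDiffSymmAt (p : M) :
    chartDiff (n := n) p p ∘ₗ chartDiffSymmAt (n := n) p = LinearMap.id := by
  have h := mfderiv_extChartAt_comp_mfderivWithin_extChartAt_symm'
    (mem_extChartAt_source (I := 𝓡 n) (M := M) p)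
  rw [ModelWithCorners.range_eq_univ, mfderivWithin_univ] at h
  exact congrArg ContinuousLinearMap.toLinearMap h

theorem inChart_interiorForm (w : Multivector n M) (a : Form n M) (p : M) {y : Model n}
    (hy : y ∈ (extChartAt (𝓡 n) p).target) :
    (interiorForm w a).inChart p y = interiorMul (w.inChart p y) (a.inChart p y) := by
  rw [Form.inChart, Form.inChart, interiorMul_map_dualMap, Multivector.inChart, map_map,
    chartDiffSymm_comp_chartDiff p hy, ExteriorAlgebra.map_id]
  rfl

/-- Pulling the expression of a form back by the chart recovers the form. -/
theorem Form.map_inChart_self (a : Form n M) (p : M) :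
    ExteriorAlgebra.map (chartDiff p p).dualMap (a.inChart p (extChartAt (𝓡 n) p p)) = a p := by
  have h : ∀ (y : Model n) (x : M), y ∈ (extChartAt (𝓡 n) p).target →
      (extChartAt (𝓡 n) p).symm y = x →
      ExteriorAlgebra.map (chartDiff p x).dualMap (a.inChart p y) = a x := by
    rintro y _ hy rfl
    rw [Form.inChart, map_map, LinearMap.dualMap_comp_dualMap, chartDiffSymm_comp_chartDiff p hy,
      LinearMap.dualMap_id, ExteriorAlgebra.map_id]
    rfl
  exact h _ _ (mem_extChartAt_target p) (extChartAt_to_inv p)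

theorem Form.IsSmooth.interior {w : Multivector n M} (hw : w.IsSmooth) {a : Form n M}
    (ha : a.IsSmooth) : (interiorForm w a).IsSmooth := fun p =>
  ((hw p).bilin (interiorBilin n) (ha p)).congr fun _ hy => inChart_interiorForm w a p hy

/-! ### The exterior derivative and Koszul's operator -/

theorem extD_mul {a b : Form n M} (ha : a.IsSmooth) (hb : b.IsSmooth) :
    extD (a * b) = extD a * b + (fun x => CliffordAlgebra.involute (a x) : Form n M) * extD b := by
  funext p
  have h : (a * b).inChart p = fun y => a.inChart p y * b.inChart p y :=
    funext fun y => Form.inChart_mul a b p y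
  rw [extD, h, localExtDeriv_mul (ha.differentiableAt p) (hb.differentiableAt p), map_add, map_mul,
    map_mul, ← involute_map, Form.map_inChart_self, Form.map_inChart_self]
  rfl

theorem koszul_add {w : Multivector n M} (hw : w.IsSmooth) {a b : Form n M} (ha : a.IsSmooth)
    (hb : b.IsSmooth) : koszul w (a + b) = koszul w a + koszul w b := by
  simp only [koszul, extD_add ha hb, interiorForm_add, extD_add (ha.interior hw) (hb.interior hw)]
  abel

theorem koszul_smul {w : Multivector n M} (hw : w.IsSmooth) (c : ℝ) {a : Form n M}
    (ha : a.IsSmooth) : koszul w (c • a) = c • koszul w a := by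
  simp only [koszul, extD_smul c ha, interiorForm_smul, extD_smul c (ha.interior hw), smul_sub]

theorem localSchouten_inChart {w : Multivector n M} (hw : IsPoisson w) (p : M) :
    localSchouten (w.inChart p) (w.inChart p) (extChartAt (𝓡 n) p p) = 0 := by
  have h : schouten w w p = 0 := by rw [hw.schouten_self]; rfl
  have h' := congrArg (ExteriorAlgebra.map (chartDiff p p)) h
  rwa [schouten, map_map, chartDiff_comp_chartDiffSymmAt, ExteriorAlgebra.map_id, map_zero] at h'

/-- On a Poisson manifold Koszul's operator commutes with `w ⊢`. -/
theorem interiorForm_koszul {w : Multivector n M} (hw : IsPoisson w) {a : Form n M}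
    (ha : a.IsSmooth) : interiorForm w (koszul w a) = koszul w (interiorForm w a) := by
  funext p
  have hopen := isOpen_extChartAt_target (I := 𝓡 n) p
  have hmem := mem_extChartAt_target (I := 𝓡 n) p
  have key := interiorMul_localSchouten (W := w.inChart p) hopen hmem
    (fun z _ => map_mem_exteriorPower _ (hw.bivector _)) (hw.smooth p) (ha p)
  rw [localSchouten_inChart hw, map_zero, LinearMap.zero_apply, neg_zero] at key
  have h1 : localExtDeriv ((interiorForm w a).inChart p) (extChartAt (𝓡 n) p p) =
      localExtDeriv (fun z => interiorMul (w.inChart p z) (a.inChart p z))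
        (extChartAt (𝓡 n) p p) := localExtDeriv_congr <| by
    filter_upwards [hopen.mem_nhds hmem] with z hz using inChart_interiorForm w a p hz
  have h2 : localExtDeriv ((interiorForm w (interiorForm w a)).inChart p)
      (extChartAt (𝓡 n) p p) = localExtDeriv (fun z => interiorMul (w.inChart p z)
        (interiorMul (w.inChart p z) (a.inChart p z))) (extChartAt (𝓡 n) p p) :=
    localExtDeriv_congr <| by
      filter_upwards [hopen.mem_nhds hmem] with z hz
      rw [inChart_interiorForm _ _ p hz, inChart_interiorForm w a p hz]
  rw [← h1, ← h2] at key
  have key' := congrArg (ExteriorAlgebra.map (chartDiff p p).dualMap) key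
  simp only [map_add, map_sub, map_smul, map_zero, ← interiorMul_map_chartDiff] at key'
  have key'' : interiorMul (w p) (interiorMul (w p) (extD a p)) -
      (2 : ℝ) • interiorMul (w p) (extD (interiorForm w a) p) +
      extD (interiorForm w (interiorForm w a)) p = 0 := key'
  change interiorMul (w p) (interiorMul (w p) (extD a p) - extD (interiorForm w a) p) =
    interiorMul (w p) (extD (interiorForm w a) p) - extD (interiorForm w (interiorForm w a)) p
  rw [map_sub, ← sub_eq_zero, ← key'']
  module

end Charts

/-! ### The Leibniz rule for the coefficients of the quantum product -/

section WedgeForm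

variable {n : ℕ} {M : Type*} [TopologicalSpace M] [ChartedSpace (Model n) M]

/-- The fiberwise `r`-fold contracted product `Tᵣ(a, b)` of forms, so that the coefficient of `hʳ`
in the quantum exterior product is `Tᵣ(a, b) / r!`. -/
def wedgeForm (w : Multivector n M) (r : ℕ) (a b : Form n M) : Form n M := fun x =>
  contractedWedge (Module.finBasis ℝ (TangentSpace (𝓡 n) x)) (w x) r (a x) (b x)

/-- `a` is multiplied by `s` under the grade involution; for `k`-forms this holds with
`s = (-1) ^ k`. -/
def HasParity (a : Form n M) (s : ℝ) : Prop :=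
  ∀ x, CliffordAlgebra.involute (a x) = s • a x

theorem wedgeForm_zero (w : Multivector n M) (a b : Form n M) : wedgeForm w 0 a b = a * b := rfl

theorem wedgeForm_add_left (w : Multivector n M) (r : ℕ) (a a' b : Form n M) :
    wedgeForm w r (a + a') b = wedgeForm w r a b + wedgeForm w r a' b :=
  funext fun _ => contractedWedge_add_left _ _ _ _ _ _

theorem wedgeForm_add_right (w : Multivector n M) (r : ℕ) (a b b' : Form n M) :
    wedgeForm w r a (b + b') = wedgeForm w r a b + wedgeForm w r a b' :=
  funext fun _ => contractedWedge_add_right _ _ _ _ _ _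

theorem wedgeForm_sub_left (w : Multivector n M) (r : ℕ) (a a' b : Form n M) :
    wedgeForm w r (a - a') b = wedgeForm w r a b - wedgeForm w r a' b := by
  rw [eq_sub_iff_add_eq, ← wedgeForm_add_left, sub_add_cancel]

theorem wedgeForm_sub_right (w : Multivector n M) (r : ℕ) (a b b' : Form n M) :
    wedgeForm w r a (b - b') = wedgeForm w r a b - wedgeForm w r a b' := by
  rw [eq_sub_iff_add_eq, ← wedgeForm_add_right, sub_add_cancel]

theorem interiorForm_sub (w : Multivector n M) (a b : Form n M) :
    interiorForm w (a - b) = interiorForm w a - interiorForm w b :=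
  funext fun x => map_sub (interiorMul (w x)) _ _

theorem wedgeForm_eq_zero (w : Multivector n M) {r : ℕ} (hr : n < r) (a b : Form n M) :
    wedgeForm w r a b = 0 :=
  funext fun _ => contractedWedge_eq_zero _ _
    (lt_of_eq_of_lt (finrank_euclideanSpace_fin (𝕜 := ℝ) (n := n)) hr) _ _

theorem wedgeForm_succ {w : Multivector n M} (hw : IsPoisson w) (r : ℕ) (a b : Form n M) :
    wedgeForm w (r + 1) a b = wedgeForm w r (interiorForm w a) b +
      wedgeForm w r a (interiorForm w b) - interiorForm w (wedgeForm w r a b) :=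
  funext fun x => contractedWedge_succ _ (hw.bivector x) _ _ _

/-- The recursion one step lower; the factor `r` makes it hold for `r = 0` too. -/
theorem smul_wedgeForm {w : Multivector n M} (hw : IsPoisson w) (r : ℕ) (a b : Form n M) :
    (r : ℝ) • wedgeForm w r a b = (r : ℝ) • (wedgeForm w (r - 1) (interiorForm w a) b +
      wedgeForm w (r - 1) a (interiorForm w b) - interiorForm w (wedgeForm w (r - 1) a b)) := by
  cases r with
  | zero => simp
  | succ r => rw [wedgeForm_succ hw, Nat.add_sub_cancel]

theorem HasParity.interior {w : Multivector n M} (hw : IsPoisson w) {a : Form n M} {s : ℝ}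
    (ha : HasParity a s) : HasParity (interiorForm w a) s := fun x => by
  rw [interiorForm, involute_interiorMul (hw.bivector x), ha x, map_smul]

theorem extD_interiorForm (w : Multivector n M) (a : Form n M) :
    extD (interiorForm w a) = interiorForm w (extD a) - koszul w a := by
  rw [koszul, sub_sub_cancel]

theorem extD_sub {a b : Form n M} (ha : a.IsSmooth) (hb : b.IsSmooth) :
    extD (a - b) = extD a - extD b := by
  rw [sub_eq_add_neg, ← neg_one_smul ℝ, extD_add ha (hb.smul _), extD_smul _ hb, neg_one_smul,
    ← sub_eq_add_neg]

variable [IsManifold (𝓡 n) ∞ M]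

theorem Form.IsSmooth.wedgeForm {w : Multivector n M} (hw : IsPoisson w) (r : ℕ) {a b : Form n M}
    (ha : a.IsSmooth) (hb : b.IsSmooth) : (wedgeForm w r a b).IsSmooth := by
  induction r generalizing a b with
  | zero => exact ha.mul hb
  | succ r ih =>
    rw [wedgeForm_succ hw, sub_eq_add_neg, ← neg_one_smul ℝ]
    exact ((ih (ha.interior hw.smooth) hb).add (ih ha (hb.interior hw.smooth))).add
      (((ih ha hb).interior hw.smooth).smul _)

theorem koszul_sub {w : Multivector n M} (hw : w.IsSmooth) {a b : Form n M} (ha : a.IsSmooth)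
    (hb : b.IsSmooth) : koszul w (a - b) = koszul w a - koszul w b := by
  rw [sub_eq_add_neg, ← neg_one_smul ℝ, koszul_add hw ha (hb.smul _), koszul_smul hw _ hb,
    neg_one_smul, ← sub_eq_add_neg]

/-- The Leibniz rule, order by order in `h`. The recursion for `Tᵣ` carries the rule from `r` to
`r + 1`, because `δ = [w ⊢, d]` commutes with `w ⊢`. For `r = 0` the term `Tᵣ₋₁` has
coefficient zero. -/
theorem extD_wedgeForm {w : Multivector n M} (hw : IsPoisson w) (r : ℕ) {s : ℝ} {a b : Form n M}
    (ha : a.IsSmooth) (hb : b.IsSmooth) (hs : HasParity a s) :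
    extD (wedgeForm w r a b) - (r : ℝ) • koszul w (wedgeForm w (r - 1) a b) =
      wedgeForm w r (extD a) b - (r : ℝ) • wedgeForm w (r - 1) (koszul w a) b +
        s • (wedgeForm w r a (extD b) - (r : ℝ) • wedgeForm w (r - 1) a (koszul w b)) := by
  induction r generalizing a b with
  | zero =>
    have h : (fun x => CliffordAlgebra.involute (a x) : Form n M) = s • a := funext hs
    simp only [Nat.cast_zero, zero_smul, sub_zero, wedgeForm_zero, extD_mul ha hb, h,
      smul_mul_assoc]
  | succ r ih =>
    have hLa := ha.interior hw.smooth
    have hLb := hb.interior hw.smooth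
    have e1 := ih hLa hb (hs.interior hw)
    have e2 := ih ha hLb hs
    have e3 := congrArg (interiorForm w) (ih ha hb hs)
    -- The recursion for `r Tᵣ`, with `δ` applied to it or to one of its arguments, turns the `Tᵣ₋₁`
    -- terms of `e1 + e2 - e3` into `r` copies of `Tᵣ`; `dL = Ld - δ` supplies one more copy.
    have k0 : (r : ℝ) • koszul w (wedgeForm w r a b) = (r : ℝ) •
        (koszul w (wedgeForm w (r - 1) (interiorForm w a) b) +
          koszul w (wedgeForm w (r - 1) a (interiorForm w b)) -
          interiorForm w (koszul w (wedgeForm w (r - 1) a b))) := by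
      have t1 := hLa.wedgeForm hw (r - 1) hb
      have t2 := ha.wedgeForm hw (r - 1) hLb
      have t3 := ha.wedgeForm hw (r - 1) hb
      have h := congrArg (koszul w) (smul_wedgeForm hw r a b)
      rwa [koszul_smul hw.smooth _ (ha.wedgeForm hw r hb), ← wedgeForm_succ hw,
        koszul_smul hw.smooth _ (ha.wedgeForm hw (r - 1 + 1) hb), wedgeForm_succ hw,
        koszul_sub hw.smooth (t1.add t2) (t3.interior hw.smooth), koszul_add hw.smooth t1 t2,
        ← interiorForm_koszul hw t3] at h
    have k1 := smul_wedgeForm hw r (koszul w a) b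
    have k2 := smul_wedgeForm hw r a (koszul w b)
    have t1 := hLa.wedgeForm hw r hb
    have t2 := ha.wedgeForm hw r hLb
    have t3 := ha.wedgeForm hw r hb
    simp only [interiorForm_add, interiorForm_sub, interiorForm_smul] at e3
    simp only [extD_interiorForm, wedgeForm_sub_left, wedgeForm_sub_right,
      ← interiorForm_koszul hw ha, ← interiorForm_koszul hw hb] at e1 e2
    rw [wedgeForm_succ hw, wedgeForm_succ hw, wedgeForm_succ hw, Nat.add_sub_cancel,
      extD_sub (t1.add t2) (t3.interior hw.smooth), extD_add t1 t2, extD_interiorForm]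
    push_cast
    linear_combination (norm := module) e1 + e2 - e3 - k0 + k1 + s • k2

end WedgeForm

/-! ### Extension to polynomials and Laurent polynomials -/

section Quantum

variable {n : ℕ} {M : Type*} [TopologicalSpace M] [ChartedSpace (Model n) M]

/-- The coefficient of `hʳ` in the quantum exterior product of forms. -/
def quantumForm (w : Multivector n M) (r : ℕ) (a b : Form n M) : Form n M := fun x =>
  quantumCoeff (w x) r (a x) (b x)

theorem quantumForm_eq (w : Multivector n M) (r : ℕ) (a b : Form n M) :
    quantumForm w r a b = (r.factorial : ℝ)⁻¹ • wedgeForm w r a b := rfl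

theorem quantumForm_add_left (w : Multivector n M) (r : ℕ) (a a' b : Form n M) :
    quantumForm w r (a + a') b = quantumForm w r a b + quantumForm w r a' b := by
  simp only [quantumForm_eq, wedgeForm_add_left, smul_add]

theorem quantumForm_add_right (w : Multivector n M) (r : ℕ) (a b b' : Form n M) :
    quantumForm w r a (b + b') = quantumForm w r a b + quantumForm w r a b' := by
  simp only [quantumForm_eq, wedgeForm_add_right, smul_add]

theorem quantumForm_zero_left (w : Multivector n M) (r : ℕ) (b : Form n M) :
    quantumForm w r 0 b = 0 :=
  map_zero (AddMonoidHom.mk' (fun a => quantumForm w r a b) fun _ _ => quantumForm_add_left ..)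

theorem quantumForm_zero_right (w : Multivector n M) (r : ℕ) (a : Form n M) :
    quantumForm w r a 0 = 0 :=
  map_zero (AddMonoidHom.mk' (quantumForm w r a) fun _ _ => quantumForm_add_right ..)

theorem quantumForm_eq_zero (w : Multivector n M) {r : ℕ} (hr : n < r) (a b : Form n M) :
    quantumForm w r a b = 0 := by
  rw [quantumForm_eq, wedgeForm_eq_zero w hr, smul_zero]

theorem isSmooth_single {Γ : Type*} (p : Γ) {a : Form n M} (ha : a.IsSmooth) (q : Γ) :
    (Finsupp.single p a q).IsSmooth := by
  classical
  rw [Finsupp.single_apply]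
  split
  exacts [ha, Form.IsSmooth.zero]

theorem isSmooth_sum {Γ κ : Type*} (s : Finset κ) {f : κ → Γ →₀ Form n M}
    (hf : ∀ k ∈ s, ∀ q, (f k q).IsSmooth) (q : Γ) : ((∑ k ∈ s, f k) q).IsSmooth := by
  rw [Finsupp.finsetSum_apply]
  exact Finset.sum_induction _ Form.IsSmooth (fun _ _ => Form.IsSmooth.add) Form.IsSmooth.zero
    fun k hk => hf k hk q

variable {Γ : Type*} [AddCommMonoidWithOne Γ]

theorem quantumWedge_single (w : Multivector n M) (p q : Γ) (a b : Form n M) :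
    quantumWedge w (Finsupp.single p a) (Finsupp.single q b) =
      ∑ r ∈ Finset.range (n + 1), Finsupp.single (p + q + (r : Γ)) (quantumForm w r a b) := by
  have h0 (r : ℕ) (a : Form n M) : quantumForm w r a 0 = 0 := quantumForm_zero_right w r a
  have h0' (r : ℕ) (b : Form n M) : quantumForm w r 0 b = 0 := quantumForm_zero_left w r b
  change ((Finsupp.single p a).sum fun p a => (Finsupp.single q b).sum fun q b =>
    ∑ r ∈ Finset.range (n + 1), Finsupp.single (p + q + (r : Γ)) (quantumForm w r a b)) = _
  rw [Finsupp.sum_single_index, Finsupp.sum_single_index]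
  · simp [h0]
  · simp [h0', Finsupp.sum]

theorem quantumWedge_add_left (w : Multivector n M) (α α' β : Γ →₀ Form n M) :
    quantumWedge w (α + α') β = quantumWedge w α β + quantumWedge w α' β := by
  classical
  refine Finsupp.sum_add_index' (h := fun p a => β.sum fun q b => ∑ r ∈ Finset.range (n + 1),
    Finsupp.single (p + q + (r : Γ)) (quantumForm w r a b)) (fun p => ?_) fun p a a' => ?_
  · simp [quantumForm_zero_left, Finsupp.sum]
  · simp only [quantumForm_add_left, Finsupp.single_add, Finset.sum_add_distrib, Finsupp.sum_add]

theorem quantumWedge_add_right (w : Multivector n M) (α β β' : Γ →₀ Form n M) :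
    quantumWedge w α (β + β') = quantumWedge w α β + quantumWedge w α β' := by
  classical
  refine Eq.trans (Finset.sum_congr rfl fun p _ => ?_) Finset.sum_add_distrib
  refine Finsupp.sum_add_index' (h := fun q b => ∑ r ∈ Finset.range (n + 1),
    Finsupp.single (p + q + (r : Γ)) (quantumForm w r (α p) b)) (fun q => ?_) fun q b b' => ?_
  · simp [quantumForm_zero_right]
  · simp only [quantumForm_add_right, Finsupp.single_add, Finset.sum_add_distrib]

/-- The quantum exterior product as a biadditive map. -/
def quantumWedgeHom (w : Multivector n M) :
    (Γ →₀ Form n M) →+ (Γ →₀ Form n M) →+ (Γ →₀ Form n M) :=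
  AddMonoidHom.mk' (fun α => AddMonoidHom.mk' (quantumWedge w α) (quantumWedge_add_right w α))
    fun α α' => AddMonoidHom.ext fun β => quantumWedge_add_left w α α' β

theorem quantumWedgeHom_apply (w : Multivector n M) (α β : Γ →₀ Form n M) :
    quantumWedgeHom w α β = quantumWedge w α β := rfl

/-- Regrouping by powers of `h`. The top power `hⁿ⁺¹` also comes with a value of `F`, which is
zero because the quantum product stops at `hⁿ`. -/
theorem sum_single_telescope (K : Γ) {F G : ℕ → Form n M} (hF : F (n + 1) = 0) :
    ∑ r ∈ Finset.range (n + 1), (Finsupp.single (K + (r : Γ)) (F r) -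
      Finsupp.single (K + (r : Γ) + 1) (G r)) = Finsupp.single K (F 0) +
    ∑ r ∈ Finset.range (n + 1), Finsupp.single (K + ((r + 1 : ℕ) : Γ)) (F (r + 1) - G r) := by
  simp only [Finsupp.single_sub, Finset.sum_sub_distrib]
  have h : ∑ r ∈ Finset.range (n + 1), Finsupp.single (K + (r : Γ)) (F r) =
      Finsupp.single K (F 0) +
        ∑ r ∈ Finset.range (n + 1), Finsupp.single (K + ((r + 1 : ℕ) : Γ)) (F (r + 1)) := by
    rw [Finset.sum_range_succ', Finset.sum_range_succ _ n, hF, Finsupp.single_zero, add_zero,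
      Nat.cast_zero, add_zero, add_comm]
  rw [h, add_sub_assoc]
  simp only [Nat.cast_add, Nat.cast_one, add_assoc]

theorem extD_zero : extD (0 : Form n M) = 0 := by
  simpa only [zero_smul] using extD_smul 0 (Form.IsSmooth.zero (n := n) (M := M))

theorem interiorForm_zero (w : Multivector n M) : interiorForm w 0 = 0 :=
  funext fun x => map_zero (interiorMul (w x))

theorem koszul_zero (w : Multivector n M) : koszul w 0 = 0 := by
  rw [koszul, interiorForm_zero, extD_zero, interiorForm_zero, sub_zero]

theorem quantumD_single (w : Multivector n M) (p : Γ) (a : Form n M) :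
    quantumD w (Finsupp.single p a) =
      Finsupp.single p (extD a) - Finsupp.single (p + 1) (koszul w a) :=
  Finsupp.sum_single_index (by simp [extD_zero, koszul_zero])

theorem quantumD_eq_sum (w : Multivector n M) (α : Γ →₀ Form n M) :
    quantumD w α = ∑ p ∈ α.support, quantumD w (Finsupp.single p (α p)) :=
  Finset.sum_congr rfl fun _ _ => (quantumD_single w _ _).symm

variable [IsManifold (𝓡 n) ∞ M]

theorem quantumD_add {w : Multivector n M} (hw : w.IsSmooth) {α α' : Γ →₀ Form n M}
    (h : ∀ p, (α p).IsSmooth) (h' : ∀ p, (α' p).IsSmooth) :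
    quantumD w (α + α') = quantumD w α + quantumD w α' := by
  classical
  have hsum (γ : Γ →₀ Form n M) (s : Finset Γ) (hs : γ.support ⊆ s) :
      quantumD w γ = ∑ p ∈ s, (Finsupp.single p (extD (γ p)) -
        Finsupp.single (p + 1) (koszul w (γ p))) :=
    Finsupp.sum_of_support_subset _ hs _ fun p _ => by simp [extD_zero, koszul_zero]
  rw [hsum (α + α') _ Finsupp.support_add, hsum α _ Finset.subset_union_left,
    hsum α' _ Finset.subset_union_right, ← Finset.sum_add_distrib]
  refine Finset.sum_congr rfl fun p _ => ?_
  rw [Finsupp.add_apply, extD_add (h p) (h' p), koszul_add hw (h p) (h' p), Finsupp.single_add,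
    Finsupp.single_add]
  abel

theorem quantumD_sum {w : Multivector n M} (hw : w.IsSmooth) {κ : Type*} (s : Finset κ)
    {f : κ → Γ →₀ Form n M} (hf : ∀ k ∈ s, ∀ q, (f k q).IsSmooth) :
    quantumD w (∑ k ∈ s, f k) = ∑ k ∈ s, quantumD w (f k) := by
  classical
  induction s using Finset.induction_on with
  | empty => exact Finsupp.sum_zero_index
  | insert k s hk ih =>
    have hs := fun j hj => hf j (Finset.mem_insert_of_mem hj)
    rw [Finset.sum_insert hk, Finset.sum_insert hk,
      quantumD_add hw (hf k (Finset.mem_insert_self k s)) (isSmooth_sum s hs), ih hs]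

theorem Form.IsSmooth.quantumForm {w : Multivector n M} (hw : IsPoisson w) (r : ℕ)
    {a b : Form n M} (ha : a.IsSmooth) (hb : b.IsSmooth) : (quantumForm w r a b).IsSmooth :=
  (ha.wedgeForm hw r hb).smul _

theorem extD_quantumForm_zero {w : Multivector n M} (hw : IsPoisson w) {s : ℝ} {a b : Form n M}
    (ha : a.IsSmooth) (hb : b.IsSmooth) (hs : HasParity a s) :
    extD (quantumForm w 0 a b) = quantumForm w 0 (extD a) b + s • quantumForm w 0 a (extD b) := by
  simpa [quantumForm_eq] using extD_wedgeForm hw 0 ha hb hs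

theorem extD_quantumForm_succ {w : Multivector n M} (hw : IsPoisson w) (r : ℕ) {s : ℝ}
    {a b : Form n M} (ha : a.IsSmooth) (hb : b.IsSmooth) (hs : HasParity a s) :
    extD (quantumForm w (r + 1) a b) - koszul w (quantumForm w r a b) =
      quantumForm w (r + 1) (extD a) b - quantumForm w r (koszul w a) b +
        s • (quantumForm w (r + 1) a (extD b) - quantumForm w r a (koszul w b)) := by
  have h := congrArg (fun x => ((r + 1).factorial : ℝ)⁻¹ • x) (extD_wedgeForm hw (r + 1) ha hb hs)
  have hr : ((r + 1).factorial : ℝ)⁻¹ * ((r + 1 : ℕ) : ℝ) = (r.factorial : ℝ)⁻¹ := by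
    rw [Nat.factorial_succ, Nat.cast_mul, mul_inv, mul_right_comm,
      inv_mul_cancel₀ (Nat.cast_ne_zero.2 r.succ_ne_zero), one_mul]
  simp only [smul_sub, smul_add, smul_smul, hr, Nat.add_sub_cancel, mul_comm _ s] at h
  simp only [← mul_assoc, mul_right_comm _ s, hr] at h
  simp only [quantumForm_eq, extD_smul _ (ha.wedgeForm hw (r + 1) hb),
    koszul_smul hw.smooth _ (ha.wedgeForm hw r hb), smul_sub, smul_smul]
  convert h using 4
  all_goals ring_nf

theorem quantumD_quantumWedge_single {w : Multivector n M} (hw : IsPoisson w) (p q : Γ) {s : ℝ}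
    {a b : Form n M} (ha : a.IsSmooth) (hb : b.IsSmooth) (hs : HasParity a s) :
    quantumD w (quantumWedge w (Finsupp.single p a) (Finsupp.single q b)) =
      quantumWedge w (quantumD w (Finsupp.single p a)) (Finsupp.single q b) +
        s • quantumWedge w (Finsupp.single p a) (quantumD w (Finsupp.single q b)) := by
  have hz (a b : Form n M) : quantumForm w (n + 1) a b = 0 :=
    quantumForm_eq_zero w n.lt_succ_self a b
  have e1 : quantumD w (quantumWedge w (Finsupp.single p a) (Finsupp.single q b)) = _ :=
    calc
      _ = ∑ r ∈ Finset.range (n + 1),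
          (Finsupp.single (p + q + (r : Γ)) (extD (quantumForm w r a b)) -
            Finsupp.single (p + q + (r : Γ) + 1) (koszul w (quantumForm w r a b))) := by
        rw [quantumWedge_single, quantumD_sum hw.smooth _ fun r _ =>
          isSmooth_single _ (ha.quantumForm hw r hb)]
        simp only [quantumD_single]
      _ = _ := sum_single_telescope _ (by rw [hz, extD_zero])
  have e2 : quantumWedge w (quantumD w (Finsupp.single p a)) (Finsupp.single q b) = _ :=
    calc
      _ = ∑ r ∈ Finset.range (n + 1),
          (Finsupp.single (p + q + (r : Γ)) (quantumForm w r (extD a) b) -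
            Finsupp.single (p + q + (r : Γ) + 1) (quantumForm w r (koszul w a) b)) := by
        rw [quantumD_single, ← quantumWedgeHom_apply, map_sub, AddMonoidHom.sub_apply,
          quantumWedgeHom_apply, quantumWedgeHom_apply, quantumWedge_single, quantumWedge_single,
          ← Finset.sum_sub_distrib]
        refine Finset.sum_congr rfl fun r _ => ?_
        rw [add_right_comm p 1 q, add_right_comm (p + q) 1]
      _ = _ := sum_single_telescope _ (hz _ _)
  have e3 : quantumWedge w (Finsupp.single p a) (quantumD w (Finsupp.single q b)) = _ :=
    calc
      _ = ∑ r ∈ Finset.range (n + 1),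
          (Finsupp.single (p + q + (r : Γ)) (quantumForm w r a (extD b)) -
            Finsupp.single (p + q + (r : Γ) + 1) (quantumForm w r a (koszul w b))) := by
        rw [quantumD_single, ← quantumWedgeHom_apply, map_sub,
          quantumWedgeHom_apply, quantumWedgeHom_apply, quantumWedge_single, quantumWedge_single,
          ← Finset.sum_sub_distrib]
        refine Finset.sum_congr rfl fun r _ => ?_
        rw [← add_assoc p q 1, add_right_comm (p + q) 1]
      _ = _ := sum_single_telescope _ (hz _ _)
  rw [e1, e2, e3, extD_quantumForm_zero hw ha hb hs]
  simp only [extD_quantumForm_succ hw _ ha hb hs, Finsupp.single_add, ← Finsupp.smul_single,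
    Finset.sum_add_distrib, smul_add, Finset.smul_sum]
  abel

theorem quantumD_quantumWedge {w : Multivector n M} (hw : IsPoisson w) {s : ℝ}
    {α β : Γ →₀ Form n M} (hα : ∀ p, (α p).IsSmooth) (hβ : ∀ p, (β p).IsSmooth)
    (hs : ∀ p ∈ α.support, HasParity (α p) s) :
    quantumD w (quantumWedge w α β) =
      quantumWedge w (quantumD w α) β + s • quantumWedge w α (quantumD w β) := by
  have hsum (α β : Γ →₀ Form n M) : quantumWedge w α β = ∑ p ∈ α.support, ∑ q ∈ β.support,
      quantumWedge w (Finsupp.single p (α p)) (Finsupp.single q (β q)) := by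
    simp only [quantumWedge_single]; rfl
  have hleft : quantumWedge w (quantumD w α) β = ∑ p ∈ α.support, ∑ q ∈ β.support,
      quantumWedge w (quantumD w (Finsupp.single p (α p))) (Finsupp.single q (β q)) := by
    conv_lhs => rw [quantumD_eq_sum, ← β.sum_single, ← quantumWedgeHom_apply, map_sum,
      AddMonoidHom.finsetSum_apply, Finsupp.sum]
    simp only [map_sum, quantumWedgeHom_apply]
  have hright : quantumWedge w α (quantumD w β) = ∑ p ∈ α.support, ∑ q ∈ β.support,
      quantumWedge w (Finsupp.single p (α p)) (quantumD w (Finsupp.single q (β q))) := by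
    conv_lhs => rw [quantumD_eq_sum, ← α.sum_single, ← quantumWedgeHom_apply, Finsupp.sum, map_sum]
    simp only [map_sum, AddMonoidHom.finsetSum_apply, quantumWedgeHom_apply]
    exact Finset.sum_comm
  have hsm (p q : Γ) : ∀ k, (quantumWedge w (Finsupp.single p (α p))
      (Finsupp.single q (β q)) k).IsSmooth := by
    rw [quantumWedge_single]
    exact isSmooth_sum _ fun r _ => isSmooth_single _ ((hα p).quantumForm hw r (hβ q))
  rw [hleft, hright, hsum, quantumD_sum hw.smooth _ fun p _ => isSmooth_sum _ fun q _ => hsm p q,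
    Finset.smul_sum, ← Finset.sum_add_distrib]
  refine Finset.sum_congr rfl fun p hp => ?_
  rw [quantumD_sum hw.smooth _ fun q _ => hsm p q, Finset.smul_sum, ← Finset.sum_add_distrib]
  exact Finset.sum_congr rfl fun q _ =>
    quantumD_quantumWedge_single hw p q (hα p) (hβ q) (hs p hp)

end Quantum

end QuantumDeRham
end

theorem mainTheorem2 {n : ℕ} {M : Type*} [TopologicalSpace M]
    [ChartedSpace (EuclideanSpace ℝ (Fin n)) M] [IsManifold (𝓡 n) ∞ M]
    (w : QuantumDeRham.Multivector n M) (hw : QuantumDeRham.IsPoisson w) :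
    (∀ (m : ℕ) (α β : ℕ →₀ QuantumDeRham.Form n M),
      (∀ p, (α p).IsSmooth) → (∀ p, (β p).IsSmooth) → QuantumDeRham.HasDegree α m →
      QuantumDeRham.quantumD w (QuantumDeRham.quantumWedge w α β) =
        QuantumDeRham.quantumWedge w (QuantumDeRham.quantumD w α) β +
          (-1 : ℝ) ^ m • QuantumDeRham.quantumWedge w α (QuantumDeRham.quantumD w β)) ∧
    (∀ (m : ℤ) (α β : ℤ →₀ QuantumDeRham.Form n M),
      (∀ p, (α p).IsSmooth) → (∀ p, (β p).IsSmooth) → QuantumDeRham.HasDegree α m →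
      QuantumDeRham.quantumD w (QuantumDeRham.quantumWedge w α β) =
        QuantumDeRham.quantumWedge w (QuantumDeRham.quantumD w α) β +
          (-1 : ℝ) ^ m • QuantumDeRham.quantumWedge w α (QuantumDeRham.quantumD w β)) := by
  -- The degree `k + 2p` has the parity of `k`.
  refine ⟨fun m α β hα hβ hm => QuantumDeRham.quantumD_quantumWedge hw hα hβ fun p hp x => ?_,
    fun m α β hα hβ hm => QuantumDeRham.quantumD_quantumWedge hw hα hβ fun p hp x => ?_⟩
  · obtain ⟨k, rfl, hk⟩ := hm p hp
    rw [QuantumDeRham.involute_of_mem_exteriorPower (hk x), smul_eq_mul, pow_add, pow_mul]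
    simp
  · obtain ⟨k, rfl, hk⟩ := hm p hp
    rw [QuantumDeRham.involute_of_mem_exteriorPower (hk x), nsmul_eq_mul,
      zpow_add₀ (by norm_num), zpow_mul]
    simp
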